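/- Let $n\ge 1$ and let $V$ be a finite-dimensional Euclidean space with inner product $(\cdot,\cdot)$. Let $\Phi\subset V$ be a reduced crystallographic root system spanning $V$, of type $A_n$, with simple roots $\alpha_1,\dots,\alpha_n$ numbered consecutively along the Dynkin diagram, and let $\alpha_0=\sum_{i=1}^n m_i\alpha_i$ be the highest root; a simple root $\alpha_j$ is called minuscule if $m_j=1$. Let $$\mathcal A=\{x\in V : (\alpha_i,x)\ge 0 \text{ for } 1\le i\le n,\ (\alpha_0,x)\le 1\}$$ be the fundamental alcove, let $$\mathcal K=\{x\in\mathcal A : (\alpha_0+\alpha_j,x)\le 1 \text{ for all minuscule } \alpha_j\}$$ be the Komrakov--Premet polytope, and put $$v_0=\sum_{i=1}^{\lfloor n/2\rfloor}(\alpha_i-\alpha_{n+1-i}),\qquad \mathcal L=\{x\in\mathcal K : (v_0,x)\ge 0\}$$ (so that $v_0=0$ and $\mathcal L=\mathcal K$ if $n=1$). Then the polytope $\mathcal L$ has exactly $$2^{n-1}+\frac{3-(-1)^n}{4}\binom{2\lfloor n/2\rfloor}{\lfloor n/2\rfloor}$$ vertices (extreme points). -/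

import Mathlib

open scoped InnerProductSpace

noncomputable section

namespace AlcovePolytope

variable {ι V : Type*} [NormedAddCommGroup V] [InnerProductSpace ℝ V]

/-- The root pairing `P` between `V` and itself is the one attached to a root system in the
Euclidean space `V`: the pairing is the inner product of `V`, and the coroot of a root `α` is
`2 α / (α, α)`, so that the reflections of `P` are the orthogonal ones. -/
def IsEuclidean (P : RootPairing ι ℝ V V) : Prop :=
  (∀ x y : V, P.toLinearMap x y = ⟪x, y⟫_ℝ) ∧
    ∀ i : ι, P.coroot i = (2 / ⟪P.root i, P.root i⟫_ℝ) • P.root i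

/-- The root with index `r` is the highest root with respect to the base `b`: its difference with
any root is a sum of simple roots. -/
def IsHighestRoot {P : RootPairing ι ℝ V V} (b : P.Base) (r : ι) : Prop :=
  ∀ i : ι, P.root r - P.root i ∈ AddSubmonoid.closure (P.root '' b.support)

/-- The simple root with index `j` is minuscule: it has coefficient `1` in the expansion of the
highest root (of index `r`) in the basis of simple roots. -/
def IsMinuscule {P : RootPairing ι ℝ V V} [P.IsRootSystem] (b : P.Base) (r : ι)
    (j : b.support) : Prop :=
  b.toWeightBasis.repr (P.root r) j = 1

/-- The fundamental alcove, where `r` is the index of the highest root. -/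
def alcove {P : RootPairing ι ℝ V V} (b : P.Base) (r : ι) : Set V :=
  {x | (∀ i : b.support, 0 ≤ ⟪P.root i, x⟫_ℝ) ∧ ⟪P.root r, x⟫_ℝ ≤ 1}

/-- The Komrakov--Premet polytope, where `r` is the index of the highest root. -/
def komrakovPremet {P : RootPairing ι ℝ V V} [P.IsRootSystem] (b : P.Base) (r : ι) : Set V :=
  {x | x ∈ alcove b r ∧ ∀ j : b.support, IsMinuscule b r j → ⟪P.root r + P.root j, x⟫_ℝ ≤ 1}

/-- The base `b` is of type `A_n`, its simple roots being numbered by `e` along the Dynkin diagram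
(the `k`-th simple root has index `e k`, with `k` counted from `0`). -/
def IsTypeA {P : RootPairing ι ℝ V V} [P.IsCrystallographic] (b : P.Base) {n : ℕ}
    (e : Fin n ≃ b.support) : Prop :=
  ∀ i j : Fin n, b.cartanMatrix (e i) (e j) = CartanMatrix.A n i j

/-- The vector `v₀ = ∑_{1 ≤ i ≤ ⌊n/2⌋} (α_i - α_{n+1-i})`. Counting from `0`, the index of
`α_{n+1-i}` is the reverse in `Fin n` of the index of `α_i`. -/
def balancedRootA {P : RootPairing ι ℝ V V} (b : P.Base) {n : ℕ} (e : Fin n ≃ b.support) : V :=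
  ∑ i : Fin n with i.val < n / 2, (P.root (e i) - P.root (e i.rev))

/-- The fundamental polytope `𝓛` of type `A_n`: the half of the Komrakov--Premet polytope on which
`v₀` is nonnegative. -/
def fundamentalPolytopeA {P : RootPairing ι ℝ V V} [P.IsRootSystem] (b : P.Base) (r : ι) {n : ℕ}
    (e : Fin n ≃ b.support) : Set V :=
  {x | x ∈ komrakovPremet b r ∧ 0 ≤ ⟪balancedRootA b e, x⟫_ℝ}

end AlcovePolytope

end

open scoped InnerProductSpace

/-! In type $A_n$ the highest root is the sum of the simple roots, so every simple root is
minuscule. In the coordinates $y_i = (\alpha_i, x)$ the polytope $\mathcal L$ becomes $\{y \ge 0,\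
\sum y + \max y \le 1,\ \sum \varepsilon_i y_i \ge 0\}$, where $\varepsilon$ is $1$ on the first
$\lfloor n/2\rfloor$ indices, $-1$ on the last $\lfloor n/2\rfloor$ and $0$ on a middle one.

Its vertices are the points $1_S/(|S|+1)$ with $\sum_{i \in S} \varepsilon_i \ge 0$, the empty set
giving the origin (`extremePoints_balancedPolytope`). The cut by $\varepsilon$ creates no new vertex
because $|\varepsilon_i| \le 1$: the $\varepsilon$-sums of $S$ and $S \cup \{i\}$ never have
strictly opposite signs.

Reversing the indices negates $\varepsilon$, so twice the number of such $S$ is $2^n$ plus the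
number of balanced $S$, and the latter is a binomial coefficient times a power of $2$. -/

open Filter Topology in
theorem eq_zero_of_mem_extremePoints_of_eventually_mem {E : Type*} [AddCommGroup E] [Module ℝ E]
    {A : Set E} {x u : E} (hx : x ∈ A.extremePoints ℝ)
    (hu : ∀ᶠ t : ℝ in 𝓝 0, x + t • u ∈ A) : u = 0 := by
  have hneg : ∀ᶠ t : ℝ in 𝓝 0, x + (-t) • u ∈ A := by
    have h : Tendsto (fun t : ℝ ↦ -t) (𝓝 0) (𝓝 0) := by
      simpa using (continuous_neg (G := ℝ)).tendsto 0
    exact h.eventually hu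
  obtain ⟨t, ⟨h₁, h₂⟩, ht⟩ :=
    (((hu.and hneg).filter_mono nhdsWithin_le_nhds).and
      (self_mem_nhdsWithin (s := Set.Ioi (0 : ℝ)))).exists
  have ht : (0 : ℝ) < t := ht
  have h := hx.2 h₁ h₂ ⟨1 / 2, 1 / 2, by norm_num, by norm_num, by norm_num, by module⟩
  have h' : t • u = 0 := by simpa using h
  exact (smul_eq_zero.mp h').resolve_left ht.ne'

/-! ### The polytope in coordinates and its extreme points -/

/-- The polytope `{y ≥ 0, ∑ y + max y ≤ 1, ∑ ε y ≥ 0}`. -/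
def balancedPolytope {κ : Type*} [Fintype κ] (ε : κ → ℤ) : Set (κ → ℝ) :=
  {y | (∀ i, 0 ≤ y i) ∧ (∀ j, ∑ i, y i + y j ≤ 1) ∧ 0 ≤ ∑ i, ε i * y i}

open Classical in
/-- The multiple of the indicator of `S` for which `∑ y + max y = 1` (if `S` is nonempty). -/
noncomputable def balancedVertex {κ : Type*} (S : Finset κ) : κ → ℝ :=
  fun i ↦ if i ∈ S then ((S.card : ℝ) + 1)⁻¹ else 0

theorem balancedVertex_injective {κ : Type*} :
    Function.Injective (balancedVertex : Finset κ → κ → ℝ) := by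
  intro S T h
  ext i
  have hi := congrFun h i
  have h₁ : ((S.card : ℝ) + 1)⁻¹ ≠ 0 := by positivity
  have h₂ : ((T.card : ℝ) + 1)⁻¹ ≠ 0 := by positivity
  simp only [balancedVertex] at hi
  refine ⟨fun hS ↦ by_contra fun hT ↦ h₁ ?_, fun hT ↦ by_contra fun hS ↦ h₂ ?_⟩
  · rwa [if_pos hS, if_neg hT] at hi
  · rw [if_neg hS, if_pos hT] at hi
    exact hi.symm

section

variable {κ : Type*} [Fintype κ]

theorem sum_balancedVertex (S : Finset κ) :
    ∑ i, balancedVertex S i = S.card * ((S.card : ℝ) + 1)⁻¹ := by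
  classical
  simp [balancedVertex, Finset.sum_ite_mem]

theorem balancedVertex_mem_iff (ε : κ → ℤ) (S : Finset κ) :
    balancedVertex S ∈ balancedPolytope ε ↔ 0 ≤ ∑ i ∈ S, ε i := by
  classical
  have hpos : (0 : ℝ) < ((S.card : ℝ) + 1)⁻¹ := by positivity
  have hsum : ∑ i, (ε i : ℝ) * balancedVertex S i =
      ((∑ i ∈ S, ε i : ℤ) : ℝ) * ((S.card : ℝ) + 1)⁻¹ := by
    simp [balancedVertex, Finset.sum_ite_mem, Finset.sum_mul]
  refine ⟨fun h ↦ ?_, fun h ↦ ⟨fun i ↦ ?_, fun j ↦ ?_, ?_⟩⟩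
  · have := h.2.2
    rw [hsum] at this
    exact_mod_cast nonneg_of_mul_nonneg_left this hpos
  · unfold balancedVertex
    split_ifs
    exacts [hpos.le, le_rfl]
  · rw [sum_balancedVertex]
    have h₁ : (S.card : ℝ) * ((S.card : ℝ) + 1)⁻¹ + ((S.card : ℝ) + 1)⁻¹ = 1 := by
      field_simp
    have h₂ : balancedVertex S j ≤ ((S.card : ℝ) + 1)⁻¹ := by
      unfold balancedVertex
      split_ifs
      exacts [le_rfl, hpos.le]
    linarith
  · rw [hsum]
    exact mul_nonneg (by exact_mod_cast h) hpos.le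

/-- Constraints tight at a proper convex combination are tight at both endpoints. Here $y_i = 0$ off
$S$ and $\sum y + y_i = 1$ on $S$ already determine the point. -/
theorem balancedVertex_mem_extremePoints {ε : κ → ℤ} {S : Finset κ}
    (hS : 0 ≤ ∑ i ∈ S, ε i) :
    balancedVertex S ∈ (balancedPolytope ε).extremePoints ℝ := by
  classical
  refine ⟨(balancedVertex_mem_iff ε S).mpr hS, ?_⟩
  rintro p hp q hq ⟨a, b, ha, hb, hab, h⟩
  have hi (i : κ) : a * p i + b * q i = balancedVertex S i := by
    rw [← h]; simp
  have hzero (i : κ) (hiS : i ∉ S) : p i = 0 := by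
    have h₁ := hi i
    simp only [balancedVertex, hiS, if_false] at h₁
    have h₂ := mul_nonneg ha.le (hp.1 i)
    have h₃ := mul_nonneg hb.le (hq.1 i)
    have h₄ : a * p i = 0 := by linarith
    exact (mul_eq_zero.mp h₄).resolve_left ha.ne'
  have hone (i : κ) (hiS : i ∈ S) : ∑ j, p j + p i = 1 := by
    have h₁ := hi i
    simp only [balancedVertex, hiS, if_true] at h₁
    have h₂ : a * ∑ j, p j + b * ∑ j, q j = S.card * ((S.card : ℝ) + 1)⁻¹ := by
      rw [← sum_balancedVertex, Finset.mul_sum, Finset.mul_sum, ← Finset.sum_add_distrib]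
      exact Finset.sum_congr rfl fun j _ ↦ hi j
    have h₃ : (S.card : ℝ) * ((S.card : ℝ) + 1)⁻¹ + ((S.card : ℝ) + 1)⁻¹ = 1 := by
      field_simp
    have h₄ := mul_le_mul_of_nonneg_left (hp.2.1 i) ha.le
    have h₅ := mul_le_mul_of_nonneg_left (hq.2.1 i) hb.le
    have h₆ : a * (∑ j, p j + p i) = a * 1 := by linarith
    exact mul_left_cancel₀ ha.ne' h₆
  have hsum : ∑ j, p j = S.card * (1 - ∑ j, p j) := by
    have h₁ : ∑ j, p j = ∑ j ∈ S, p j :=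
      (Finset.sum_subset (Finset.subset_univ S) fun j _ hj ↦ hzero j hj).symm
    have h₂ : ∑ j ∈ S, p j = ∑ _j ∈ S, (1 - ∑ l, p l) :=
      Finset.sum_congr rfl fun j hj ↦ by linarith [hone j hj]
    rw [Finset.sum_const, nsmul_eq_mul] at h₂
    linarith
  ext i
  by_cases hiS : i ∈ S
  · have := hone i hiS
    simp only [balancedVertex, hiS, if_true]
    apply eq_inv_of_mul_eq_one_left
    have h' : p i = 1 - ∑ j, p j := by linarith
    rw [h']
    linarith
  · simp [balancedVertex, hiS, hzero i hiS]

open Filter Topology in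
/-- Directions along which every tight constraint at an extreme point stays tight vanish. -/
theorem eq_zero_of_mem_extremePoints_balancedPolytope {ε : κ → ℤ} {x : κ → ℝ}
    (hx : x ∈ (balancedPolytope ε).extremePoints ℝ) {M : ℝ} (hM : ∀ i, x i ≤ M)
    {u : κ → ℝ} {s : ℝ} (h₀ : ∀ i, x i = 0 → u i = 0) (h₁ : ∀ i, x i = M → u i = s)
    (h₂ : ∑ i, x i + M = 1 → ∑ i, u i + s = 0)
    (hle : ∑ i, x i + M ≤ 1)
    (h₃ : ∑ i, ε i * x i = 0 → ∑ i, ε i * u i = 0) : u = 0 := by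
  refine eq_zero_of_mem_extremePoints_of_eventually_mem hx ?_
  -- A strict constraint survives small $t$ by continuity; a tight one survives because its slope
  -- $c$ is zero.
  have key (a b c : ℝ) (hab : a ≤ b) (h : a = b → c = 0) :
      ∀ᶠ t : ℝ in 𝓝 0, a + t * c ≤ b := by
    rcases hab.eq_or_lt with rfl | hlt
    · simp [h rfl]
    · have hc : Tendsto (fun t : ℝ ↦ a + t * c) (𝓝 0) (𝓝 a) := by
        have : Continuous fun t : ℝ ↦ a + t * c := by fun_prop
        simpa using this.tendsto 0
      exact (hc.eventually_lt_const hlt).mono fun t ht ↦ ht.le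
  have e₁ : ∀ᶠ t : ℝ in 𝓝 0, ∀ i, -x i + t * (-u i) ≤ 0 :=
    eventually_all.mpr fun i ↦ key _ _ _ (by linarith [hx.1.1 i])
      fun h ↦ by rw [h₀ i (by linarith), neg_zero]
  have e₂ : ∀ᶠ t : ℝ in 𝓝 0, ∀ j, (∑ i, x i + x j) + t * (∑ i, u i + u j) ≤ 1 :=
    eventually_all.mpr fun j ↦ key _ _ _ (hx.1.2.1 j) fun h ↦ by
      have hj : x j = M := le_antisymm (hM j) (by linarith)
      rw [h₁ j hj]
      exact h₂ (by rw [← hj]; exact h)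
  have e₃ : ∀ᶠ t : ℝ in 𝓝 0, -(∑ i, ε i * x i) + t * -(∑ i, ε i * u i) ≤ 0 :=
    key _ _ _ (by linarith [hx.1.2.2]) fun h ↦ by rw [h₃ (by linarith), neg_zero]
  filter_upwards [e₁, e₂, e₃] with t h₁ h₂ h₃
  refine ⟨fun i ↦ ?_, fun j ↦ ?_, ?_⟩
  · have := h₁ i
    simp only [Pi.add_apply, Pi.smul_apply, smul_eq_mul]
    linarith
  · have := h₂ j
    simp only [Pi.add_apply, Pi.smul_apply, smul_eq_mul, Finset.sum_add_distrib,
      ← Finset.mul_sum]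
    linarith
  · simp only [Pi.add_apply, Pi.smul_apply, smul_eq_mul, mul_add, Finset.sum_add_distrib,
      mul_left_comm _ t, ← Finset.mul_sum]
    linarith

theorem exists_ne_zero_orthogonal_pair (k α β d : ℝ) :
    ∃ a b s : ℝ, ¬ (a = 0 ∧ b = 0 ∧ s = 0) ∧ a + b + s * k = 0 ∧ α * a + β * b + s * d = 0 := by
  by_cases h : d - k * β = 0 ∧ k * α - d = 0 ∧ β - α = 0
  · exact ⟨1, -1, 0, by simp, by ring, by linarith [h.2.2]⟩
  -- The witness is the cross product of $(1, 1, k)$ and $(\alpha, \beta, d)$; the other case is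
  -- that of parallel vectors.
  · exact ⟨_, _, _, h, by ring, by ring⟩

/-- Any coordinate strictly between $0$ and the maximum $M$ leaves room to perturb: two of them give
three parameters against two equations, and a single one makes the $\varepsilon$-constraint either
slack or trivial. -/
theorem exists_eq_balancedVertex_of_mem_extremePoints {ε : κ → ℤ} (hε : ∀ i, |ε i| ≤ 1)
    {x : κ → ℝ} (hx : x ∈ (balancedPolytope ε).extremePoints ℝ) :
    ∃ S, x = balancedVertex S := by
  classical
  by_cases hx0 : x = 0
  · exact ⟨∅, by ext i; simp [hx0, balancedVertex]⟩
  obtain ⟨i₁, hi₁⟩ := Function.ne_iff.mp hx0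
  have : Nonempty κ := ⟨i₁⟩
  obtain ⟨i₀, hi₀⟩ := Finite.exists_max x
  set M := x i₀ with hMdef
  have hMpos : 0 < M := lt_of_lt_of_le (lt_of_le_of_ne (hx.1.1 i₁) (Ne.symm hi₁)) (hi₀ i₁)
  have hle : ∑ i, x i + M ≤ 1 := hx.1.2.1 i₀
  -- Otherwise $x$ could be rescaled in both directions.
  have tight : ∑ i, x i + M = 1 := by
    by_contra hne
    exact hx0 <| eq_zero_of_mem_extremePoints_balancedPolytope hx hi₀ (u := x) (s := M)
      (fun _ h ↦ h) (fun _ h ↦ h) (fun h ↦ absurd h hne) hle (fun h ↦ h)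
  set S : Finset κ := Finset.univ.filter fun i ↦ x i = M with hS
  have memS (i : κ) : i ∈ S ↔ x i = M := by simp [hS]
  set d : ℤ := ∑ i ∈ S, ε i with hd
  have sum_dir (s a b : ℝ) (i j : κ) :
      ∑ l, ((if l ∈ S then s else 0) + (if l = i then a else 0) + (if l = j then b else 0)) =
        s * S.card + a + b := by
    simp [Finset.sum_add_distrib, Finset.sum_ite_mem, mul_comm]
  have sum_dir' (s a b : ℝ) (i j : κ) :
      ∑ l, ε l * ((if l ∈ S then s else 0) + (if l = i then a else 0) +
        (if l = j then b else 0)) = s * d + ε i * a + ε j * b := by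
    simp [mul_add, Finset.sum_add_distrib, Finset.sum_ite_mem, mul_comm, hd, Finset.mul_sum]
  by_cases hT : ∃ i, x i ≠ 0 ∧ x i ≠ M
  · exfalso
    obtain ⟨i, hi, hiM⟩ := hT
    have hiS : i ∉ S := fun h ↦ hiM ((memS i).mp h)
    have hi₀i : i₀ ≠ i := fun h ↦ hiM (by rw [← h])
    by_cases hT' : ∃ j, j ≠ i ∧ x j ≠ 0 ∧ x j ≠ M
    · obtain ⟨j, hji, hj, hjM⟩ := hT'
      have hjS : j ∉ S := fun h ↦ hjM ((memS j).mp h)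
      have hi₀j : i₀ ≠ j := fun h ↦ hjM (by rw [← h])
      -- Move by $s$ on $S$, $a$ at $i$ and $b$ at $j$. Keeping $\sum x + M$ fixed costs $s$ once
      -- per element of $S$ and once more for $M$, hence $|S| + 1$.
      obtain ⟨a, b, s, hne, h₁, h₂⟩ := exists_ne_zero_orthogonal_pair (S.card + 1) (ε i) (ε j) d
      have hu := eq_zero_of_mem_extremePoints_balancedPolytope hx hi₀
        (u := fun l ↦ (if l ∈ S then s else 0) + (if l = i then a else 0) +
          (if l = j then b else 0)) (s := s)
        (fun l hl ↦ by
          have h₁ : l ∉ S := fun h ↦ hMpos.ne' (((memS l).mp h).symm.trans hl)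
          have h₂ : l ≠ i := fun h ↦ hi (h ▸ hl)
          have h₃ : l ≠ j := fun h ↦ hj (h ▸ hl)
          simp [h₁, h₂, h₃])
        (fun l hl ↦ by
          have h₁ : l ∈ S := (memS l).mpr hl
          have h₂ : l ≠ i := fun h ↦ hiM (h ▸ hl)
          have h₃ : l ≠ j := fun h ↦ hjM (h ▸ hl)
          simp [h₁, h₂, h₃])
        (fun _ ↦ by rw [sum_dir]; linarith) hle
        (fun _ ↦ by rw [sum_dir']; linarith)
      refine hne ⟨?_, ?_, ?_⟩
      · simpa [hiS, hji.symm] using congrFun hu i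
      · simpa [hjS, hji] using congrFun hu j
      · simpa [(memS i₀).mpr rfl, hi₀i, hi₀j] using congrFun hu i₀
    · push Not at hT'
      -- The vacuous last summand matches the shape of `sum_dir'`.
      have hxeq (l : κ) : x l = (if l ∈ S then M else 0) + (if l = i then x i else 0) +
          (if l = i then 0 else 0) := by
        by_cases hli : l = i
        · simp [hli, hiS]
        · by_cases hlS : l ∈ S
          · simpa [hli, hlS] using (memS l).mp hlS
          · have : x l = 0 := by
              by_contra h
              exact hlS ((memS l).mpr (hT' l hli h))
            simp [hli, hlS, this]
      have hεx : ∑ l, ε l * x l = M * d + ε i * x i := by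
        rw [Finset.sum_congr rfl fun l _ ↦ congrArg _ (hxeq l), sum_dir']
        ring
      have hxi : 0 < x i := lt_of_le_of_ne (hx.1.1 i) (Ne.symm hi)
      have hxiM : x i < M := lt_of_le_of_ne (hi₀ i) hiM
      -- From $M d = -\varepsilon_i x_i$ and $0 < x_i < M$ one gets $|d| < 1$, so the integer $d$
      -- vanishes.
      have hbal : ∑ l, ε l * x l = 0 → d = 0 ∧ ε i = 0 := by
        intro h
        rw [hεx] at h
        have hεi := abs_le.mp (hε i)
        have hl : (-1 : ℝ) ≤ ε i := by exact_mod_cast hεi.1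
        have hr : (ε i : ℝ) ≤ 1 := by exact_mod_cast hεi.2
        have hd0 : d = 0 := by
          have h₁ : d < 1 := by
            by_contra! hd1
            have : (1 : ℝ) ≤ d := by exact_mod_cast hd1
            nlinarith
          have h₂ : -1 < d := by
            by_contra! hd1
            have : (d : ℝ) ≤ -1 := by exact_mod_cast hd1
            nlinarith
          lia
        refine ⟨hd0, ?_⟩
        rw [hd0] at h
        simpa [hi] using h
      have hu := eq_zero_of_mem_extremePoints_balancedPolytope hx hi₀
        (u := fun l ↦ (if l ∈ S then -1 else 0) + (if l = i then (S.card + 1 : ℝ) else 0) +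
          (if l = i then 0 else 0)) (s := -1)
        (fun l hl ↦ by
          have h₁ : l ∉ S := fun h ↦ hMpos.ne' (((memS l).mp h).symm.trans hl)
          have h₂ : l ≠ i := fun h ↦ hi (h ▸ hl)
          simp [h₁, h₂])
        (fun l hl ↦ by
          have h₁ : l ∈ S := (memS l).mpr hl
          have h₂ : l ≠ i := fun h ↦ hiM (h ▸ hl)
          simp [h₁, h₂])
        (fun _ ↦ by rw [sum_dir]; ring) hle
        (fun h ↦ by rw [sum_dir', (hbal h).1, (hbal h).2]; simp)
      simpa [(memS i₀).mpr rfl, hi₀i] using congrFun hu i₀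
  · push Not at hT
    have hxeq (l : κ) : x l = if l ∈ S then M else 0 := by
      by_cases hlS : l ∈ S
      · simpa [hlS] using (memS l).mp hlS
      · have : x l = 0 := by
          by_contra h
          exact hlS ((memS l).mpr (hT l h))
        simp [hlS, this]
    have hsum : ∑ l, x l = S.card * M := by
      rw [Finset.sum_congr rfl fun l _ ↦ hxeq l]
      simp [Finset.sum_ite_mem]
    have hMeq : M = ((S.card : ℝ) + 1)⁻¹ := by
      apply eq_inv_of_mul_eq_one_left
      rw [hsum] at tight
      linarith
    refine ⟨S, funext fun l ↦ ?_⟩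
    rw [hxeq l, hMeq]
    simp only [balancedVertex]

theorem extremePoints_balancedPolytope {ε : κ → ℤ} (hε : ∀ i, |ε i| ≤ 1) :
    (balancedPolytope ε).extremePoints ℝ = balancedVertex '' {S | 0 ≤ ∑ i ∈ S, ε i} := by
  ext x
  refine ⟨fun hx ↦ ?_, ?_⟩
  · obtain ⟨S, rfl⟩ := exists_eq_balancedVertex_of_mem_extremePoints hε hx
    exact ⟨S, (balancedVertex_mem_iff ε S).mp hx.1, rfl⟩
  · rintro ⟨S, hS, rfl⟩
    exact balancedVertex_mem_extremePoints hS

end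

/-! ### Counting the subsets with nonnegative sign sum -/

theorem card_filter_card_inter_eq {κ : Type*} [Fintype κ] [DecidableEq κ] (C : Finset κ) (k : ℕ) :
    (Finset.univ.filter fun T : Finset κ ↦ (T ∩ C).card = k).card =
      C.card.choose k * 2 ^ Cᶜ.card := by
  rw [← Finset.card_powersetCard, ← Finset.card_powerset, ← Finset.card_product]
  refine Finset.card_nbij' (fun T ↦ (T ∩ C, T ∩ Cᶜ)) (fun p ↦ p.1 ∪ p.2) ?_ ?_ ?_ ?_
  · intro T hT
    have hT : (T ∩ C).card = k := by simpa using hT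
    simp [Finset.mem_powersetCard, hT]
  · rintro ⟨U, W⟩ h
    simp only [Finset.coe_product, Set.mem_prod, Finset.mem_coe, Finset.mem_powersetCard,
      Finset.mem_powerset] at h
    have : (U ∪ W) ∩ C = U := by
      ext i
      have h₁ := @h.1.1 i
      have h₂ := @h.2 i
      simp only [Finset.mem_compl] at h₂
      simp only [Finset.mem_inter, Finset.mem_union]
      tauto
    simp [this, h.1.2]
  · intro T _
    simp [← Finset.inter_union_distrib_left]
  · rintro ⟨U, W⟩ h
    simp only [Finset.coe_product, Set.mem_prod, Finset.mem_coe, Finset.mem_powersetCard,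
      Finset.mem_powerset] at h
    refine Prod.ext ?_ ?_
    all_goals
      ext i
      have h₁ := @h.1.1 i
      have h₂ := @h.2 i
      simp only [Finset.mem_compl] at h₂
      simp only [Finset.mem_inter, Finset.mem_union, Finset.mem_compl]
      tauto

/-- Complementing $S$ inside $B$ turns the condition into $|S' \cap (A \cup B)| = |B|$. -/
theorem card_filter_card_inter_eq_card_inter {κ : Type*} [Fintype κ] [DecidableEq κ]
    {A B : Finset κ} (hAB : Disjoint A B) :
    (Finset.univ.filter fun S : Finset κ ↦ (S ∩ A).card = (S ∩ B).card).card =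
      (A.card + B.card).choose B.card * 2 ^ (A ∪ B)ᶜ.card := by
  rw [← Finset.card_union_of_disjoint hAB, ← card_filter_card_inter_eq]
  have key (S : Finset κ) : (symmDiff S B ∩ (A ∪ B)).card + (S ∩ B).card =
      (S ∩ A).card + B.card := by
    have h₁ : symmDiff S B ∩ (A ∪ B) = (S ∩ A) ∪ (B \ S) := by
      ext i
      have : i ∈ A → i ∉ B := fun h h' ↦ Finset.disjoint_left.mp hAB h h'
      simp only [Finset.mem_inter, Finset.mem_symmDiff, Finset.mem_union, Finset.mem_sdiff]
      tauto
    have h₂ : Disjoint (S ∩ A) (B \ S) := by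
      rw [Finset.disjoint_left]
      intro i hi hi'
      exact (Finset.mem_sdiff.mp hi').2 (Finset.mem_inter.mp hi).1
    rw [h₁, Finset.card_union_of_disjoint h₂, add_assoc, Finset.inter_comm S B,
      Finset.card_sdiff_add_card_inter]
  refine Finset.card_nbij' (fun S ↦ symmDiff S B) (fun S ↦ symmDiff S B) ?_ ?_ ?_ ?_
  · intro S hS
    have hS : (S ∩ A).card = (S ∩ B).card := by simpa using hS
    have := key S
    simp only [Finset.coe_filter, Finset.mem_univ, true_and, Set.mem_ofPred_eq]
    lia
  · intro S hS
    have hS : (S ∩ (A ∪ B)).card = B.card := by simpa using hS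
    have := key (symmDiff S B)
    rw [symmDiff_symmDiff_cancel_right] at this
    simp only [Finset.coe_filter, Finset.mem_univ, true_and, Set.mem_ofPred_eq]
    lia
  · intro S _
    exact symmDiff_symmDiff_cancel_right B S
  · intro S _
    exact symmDiff_symmDiff_cancel_right B S

/-- If `σ` changes the sign of `ε`, the subsets with nonnegative `ε`-sum and those with
nonpositive `ε`-sum are equinumerous. -/
theorem two_mul_card_filter_sum_nonneg {κ : Type*} [Fintype κ] (σ : κ ≃ κ)
    {ε : κ → ℤ} (hσ : ∀ i, ε (σ i) = -ε i) :
    2 * (Finset.univ.filter fun S : Finset κ ↦ 0 ≤ ∑ i ∈ S, ε i).card =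
      2 ^ Fintype.card κ + (Finset.univ.filter fun S : Finset κ ↦ ∑ i ∈ S, ε i = 0).card := by
  classical
  have h₁ : (Finset.univ.filter fun S : Finset κ ↦ 0 ≤ ∑ i ∈ S, ε i).card =
      (Finset.univ.filter fun S : Finset κ ↦ ∑ i ∈ S, ε i ≤ 0).card := by
    refine Finset.card_equiv σ.finsetCongr fun S ↦ ?_
    simp [hσ]
  have h₂ := Finset.card_union_add_card_inter
    (Finset.univ.filter fun S : Finset κ ↦ 0 ≤ ∑ i ∈ S, ε i)
    (Finset.univ.filter fun S : Finset κ ↦ ∑ i ∈ S, ε i ≤ 0)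
  rw [← Finset.filter_or, ← Finset.filter_and, ← h₁] at h₂
  rw [two_mul, ← h₂]
  congr 1
  · rw [Finset.filter_true_of_mem fun S _ ↦ le_total _ _]
    simp
  · congr 1
    ext S
    simp only [Finset.mem_filter, Finset.mem_univ, true_and]
    lia

/-- The coefficients of `y ↦ ∑_{i < n / 2} (y i - y i.rev)`. -/
def balancedSign (n : ℕ) (i : Fin n) : ℤ :=
  (if i.val < n / 2 then 1 else 0) - (if i.rev.val < n / 2 then 1 else 0)

theorem abs_balancedSign_le_one (n : ℕ) (i : Fin n) : |balancedSign n i| ≤ 1 := by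
  unfold balancedSign
  split_ifs <;> simp

theorem balancedSign_rev (n : ℕ) (i : Fin n) : balancedSign n i.rev = -balancedSign n i := by
  simp [balancedSign]

theorem sum_balancedSign_mul (n : ℕ) (y : Fin n → ℝ) :
    ∑ i, balancedSign n i * y i = ∑ i : Fin n with i.val < n / 2, (y i - y i.rev) := by
  have h : ∑ i : Fin n, (if i.rev.val < n / 2 then y i else 0) =
      ∑ i : Fin n, if i.val < n / 2 then y i.rev else 0 := by
    rw [← Equiv.sum_comp Fin.revPerm]
    simp
  rw [Finset.sum_filter]
  calc ∑ i, balancedSign n i * y i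
      = ∑ i : Fin n, ((if i.val < n / 2 then y i else 0) -
          (if i.rev.val < n / 2 then y i else 0)) := by
        refine Finset.sum_congr rfl fun i _ ↦ ?_
        unfold balancedSign
        split_ifs <;> simp
    _ = _ := by
        rw [Finset.sum_sub_distrib, h, ← Finset.sum_sub_distrib]
        refine Finset.sum_congr rfl fun i _ ↦ ?_
        split_ifs <;> simp

theorem card_filter_sum_balancedSign_eq_zero (n : ℕ) :
    (Finset.univ.filter fun S : Finset (Fin n) ↦ ∑ i ∈ S, balancedSign n i = 0).card =
      (2 * (n / 2)).choose (n / 2) * 2 ^ (n - 2 * (n / 2)) := by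
  set A : Finset (Fin n) := Finset.univ.filter fun i ↦ i.val < n / 2 with hA
  set B : Finset (Fin n) := Finset.univ.filter fun i ↦ i.rev.val < n / 2 with hB
  have hAB : Disjoint A B := by
    rw [Finset.disjoint_left]
    intro i hi hi'
    simp only [hA, hB, Finset.mem_filter, Finset.mem_univ, true_and, Fin.val_rev] at hi hi'
    lia
  have hAc : A.card = n / 2 := by
    rw [hA, Fin.card_filter_val_lt]
    lia
  have hBc : B.card = n / 2 := by
    rw [← hAc]
    exact (Finset.card_equiv Fin.revPerm fun i ↦ by simp [hA, hB, -Fin.val_rev]).symm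
  have hsum (S : Finset (Fin n)) :
      ∑ i ∈ S, balancedSign n i = (S ∩ A).card - (S ∩ B).card := by
    simp only [balancedSign, Finset.sum_sub_distrib, Finset.sum_boole]
    congr 3
    all_goals ext i; simp [hA, hB]
  have h := card_filter_card_inter_eq_card_inter hAB
  rw [Finset.card_compl, Finset.card_union_of_disjoint hAB, hAc, hBc, Fintype.card_fin,
    ← two_mul] at h
  rw [← h]
  congr 1
  ext S
  simp only [Finset.mem_filter, Finset.mem_univ, true_and, hsum]
  lia

theorem card_filter_sum_balancedSign_nonneg {n : ℕ} (hn : 1 ≤ n) :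
    ((Finset.univ.filter fun S : Finset (Fin n) ↦ 0 ≤ ∑ i ∈ S, balancedSign n i).card : ℚ) =
      2 ^ (n - 1) + (3 - (-1) ^ n) / 4 * ((2 * (n / 2)).choose (n / 2) : ℚ) := by
  have h := two_mul_card_filter_sum_nonneg Fin.revPerm (balancedSign_rev n)
  rw [card_filter_sum_balancedSign_eq_zero, Fintype.card_fin] at h
  have h' : (2 : ℚ) * (Finset.univ.filter fun S : Finset (Fin n) ↦
      0 ≤ ∑ i ∈ S, balancedSign n i).card =
      2 ^ n + (2 * (n / 2)).choose (n / 2) * 2 ^ (n - 2 * (n / 2)) := by exact_mod_cast h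
  have hpow : (2 : ℚ) ^ n = 2 * 2 ^ (n - 1) := by
    rw [← pow_succ', Nat.sub_add_cancel hn]
  -- The factor $(3 - (-1)^n)/4$ is half of $2^{n - 2\lfloor n/2\rfloor}$: $1/2$ for even $n$ and
  -- $1$ for odd $n$.
  rcases Nat.even_or_odd n with he | ho
  · have : n - 2 * (n / 2) = 0 := by have := Nat.even_iff.mp he; lia
    rw [this] at h'
    rw [he.neg_one_pow]
    linarith
  · have : n - 2 * (n / 2) = 1 := by have := Nat.odd_iff.mp ho; lia
    rw [this] at h'
    rw [ho.neg_one_pow]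
    linarith

/-! ### Root lengths and the highest root in type $A_n$ -/

namespace AlcovePolytope

section Euclidean

variable {ι V : Type*} [NormedAddCommGroup V] [InnerProductSpace ℝ V] {P : RootPairing ι ℝ V V}

theorem IsEuclidean.pairing_eq (hP : IsEuclidean P) (i j : ι) :
    P.pairing i j = 2 * ⟪P.root i, P.root j⟫_ℝ / ⟪P.root j, P.root j⟫_ℝ := by
  rw [← P.root_coroot_eq_pairing, hP.1, hP.2, real_inner_smul_right]
  ring

theorem IsEuclidean.inner_root_self_pos (hP : IsEuclidean P) (i : ι) :
    0 < ⟪P.root i, P.root i⟫_ℝ := by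
  refine lt_of_le_of_ne real_inner_self_nonneg fun h ↦ ?_
  have h₁ := hP.pairing_eq i i
  rw [← h, P.pairing_same] at h₁
  simp at h₁

theorem IsEuclidean.two_mul_inner_root (hP : IsEuclidean P) (i j : ι) :
    2 * ⟪P.root i, P.root j⟫_ℝ = P.pairing i j * ⟪P.root j, P.root j⟫_ℝ := by
  rw [hP.pairing_eq, div_mul_cancel₀ _ (hP.inner_root_self_pos j).ne']

theorem IsEuclidean.inner_root_reflectionPerm_self (hP : IsEuclidean P) (i j : ι) :
    ⟪P.root (P.reflectionPerm i j), P.root (P.reflectionPerm i j)⟫_ℝ =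
      ⟪P.root j, P.root j⟫_ℝ := by
  have h := hP.two_mul_inner_root j i
  rw [P.root_reflectionPerm, P.reflection_apply_root, inner_sub_left, inner_sub_right,
    inner_sub_right, real_inner_smul_left, real_inner_smul_left, real_inner_smul_right,
    real_inner_smul_right, real_inner_comm (P.root j) (P.root i)]
  linear_combination (-P.pairing j i) * h

end Euclidean

section TypeA

variable {ι V : Type*} [NormedAddCommGroup V] [InnerProductSpace ℝ V]
  {P : RootPairing ι ℝ V V} [P.IsCrystallographic]
  {b : P.Base} {n : ℕ} {e : Fin n ≃ b.support}

theorem IsTypeA.pairing_eq (hA : IsTypeA b e) (i j : Fin n) :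
    P.pairing (e i) (e j) = (CartanMatrix.A n i j : ℤ) := by
  rw [← hA i j]
  exact (b.algebraMap_cartanMatrixIn_apply ℤ (e i) (e j)).symm

theorem IsTypeA.inner_self_eq_of_val_eq_succ (hP : IsEuclidean P) (hA : IsTypeA b e)
    {i j : Fin n} (hij : j.val = i.val + 1) :
    ⟪P.root (e j), P.root (e j)⟫_ℝ = ⟪P.root (e i), P.root (e i)⟫_ℝ := by
  have hne : i ≠ j := fun h ↦ by rw [h] at hij; lia
  have h₁ := hP.two_mul_inner_root (e i) (e j)
  have h₂ := hP.two_mul_inner_root (e j) (e i)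
  rw [hA.pairing_eq] at h₁ h₂
  simp only [CartanMatrix.A, Matrix.of_apply, hne, hne.symm, hij, if_false, true_or, or_true,
    if_true] at h₁ h₂
  rw [real_inner_comm] at h₂
  push_cast at h₁ h₂
  linarith

theorem IsTypeA.inner_simple_self_eq (hP : IsEuclidean P) (hA : IsTypeA b e) (i j : Fin n) :
    ⟪P.root (e i), P.root (e i)⟫_ℝ = ⟪P.root (e j), P.root (e j)⟫_ℝ := by
  have key (k : ℕ) (hk : k < n) : ⟪P.root (e ⟨k, hk⟩), P.root (e ⟨k, hk⟩)⟫_ℝ =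
      ⟪P.root (e ⟨0, by lia⟩), P.root (e ⟨0, by lia⟩)⟫_ℝ := by
    induction k with
    | zero => rfl
    | succ k ih =>
      rw [← ih (by lia)]
      exact hA.inner_self_eq_of_val_eq_succ hP rfl
  exact (key i i.2).trans (key j j.2).symm

/-- Reflections preserve length, every root is reached from a simple one by reflections, and
neighbouring simple roots have equal length. -/
theorem IsTypeA.inner_root_self_eq [Finite ι] [P.IsReduced] (hP : IsEuclidean P) (hA : IsTypeA b e)
    (i j : ι) : ⟪P.root i, P.root i⟫_ℝ = ⟪P.root j, P.root j⟫_ℝ := by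
  have key (k : Fin n) (i : ι) :
      ⟪P.root i, P.root i⟫_ℝ = ⟪P.root (e k), P.root (e k)⟫_ℝ := by
    refine b.induction_reflect i (p := fun i ↦ ⟪P.root i, P.root i⟫_ℝ =
      ⟪P.root (e k), P.root (e k)⟫_ℝ) (fun i hi ↦ ?_) (fun i hi ↦ ?_) (fun i j hi _ ↦ ?_)
    · rwa [hP.inner_root_reflectionPerm_self]
    · simpa using hA.inner_simple_self_eq hP (e.symm ⟨i, hi⟩) k
    · rwa [hP.inner_root_reflectionPerm_self]
  have : Nonempty ι := ⟨i⟩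
  obtain ⟨l, hl⟩ := b.support_nonempty
  exact (key (e.symm ⟨l, hl⟩) i).trans (key (e.symm ⟨l, hl⟩) j).symm

/-- Only the last summand pairs nontrivially with the next simple root, with value $-1$, so
reflecting in that root adds it to the sum. -/
theorem IsTypeA.exists_root_eq_partial_sum (hA : IsTypeA b e) (k : ℕ) (hk : k < n) :
    ∃ t, P.root t = ∑ i : Fin n with i.val ≤ k, P.root (e i) := by
  induction k with
  | zero =>
    refine ⟨e ⟨0, hk⟩, ?_⟩
    rw [Finset.sum_eq_single (⟨0, hk⟩ : Fin n)]
    · intro i hi hi'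
      exact absurd (Fin.ext (by simpa using hi)) hi'
    · simp
  | succ k ih =>
    obtain ⟨t, ht⟩ := ih (by lia)
    have hpair : P.pairing t (e ⟨k + 1, hk⟩) = -1 := by
      rw [← P.root_coroot_eq_pairing, ht, map_sum, LinearMap.sum_apply,
        Finset.sum_eq_single (⟨k, by lia⟩ : Fin n)]
      · rw [P.root_coroot_eq_pairing, hA.pairing_eq]
        simp [CartanMatrix.A]
      · intro i hi hi'
        have hi : i.val ≤ k := by simpa using hi
        have hik : i.val ≠ k := fun h ↦ hi' (Fin.ext h)
        have h₁ : i ≠ ⟨k + 1, hk⟩ := fun h ↦ by rw [h] at hi; simp at hi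
        rw [P.root_coroot_eq_pairing, hA.pairing_eq]
        simp only [CartanMatrix.A, Matrix.of_apply, h₁, if_false]
        rw [if_neg (by lia)]
        simp
      · simp
    refine ⟨P.reflectionPerm (e ⟨k + 1, hk⟩) t, ?_⟩
    have hfilter : (Finset.univ.filter fun i : Fin n ↦ i.val ≤ k + 1) =
        insert ⟨k + 1, hk⟩ (Finset.univ.filter fun i : Fin n ↦ i.val ≤ k) := by
      ext i
      simp only [Finset.mem_filter, Finset.mem_univ, true_and, Finset.mem_insert, Fin.ext_iff]
      lia
    rw [P.root_reflectionPerm, P.reflection_apply_root, hpair, hfilter,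
      Finset.sum_insert (by simp), ht]
    module

theorem IsTypeA.exists_root_eq_sum (hA : IsTypeA b e) (hn : 1 ≤ n) :
    ∃ t, P.root t = ∑ i, P.root (e i) := by
  obtain ⟨t, ht⟩ := hA.exists_root_eq_partial_sum (n - 1) (by lia)
  refine ⟨t, ht.trans ?_⟩
  rw [Finset.filter_true_of_mem fun i _ ↦ by lia]

/-- A column sum is $2$ minus the number of neighbours in the diagram. This makes $\sum \alpha_i$
dominant. -/
theorem sum_cartanMatrix_A_nonneg (n : ℕ) (j : Fin n) : 0 ≤ ∑ i, CartanMatrix.A n i j := by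
  have h (i : Fin n) : CartanMatrix.A n i j = (if i = j then 2 else 0) -
      (if i.val + 1 = j.val then 1 else 0) - (if j.val + 1 = i.val then 1 else 0) := by
    simp only [CartanMatrix.A, Matrix.of_apply, Fin.ext_iff]
    split_ifs <;> lia
  have h₁ : (Finset.univ.filter fun i : Fin n ↦ i.val + 1 = j.val).card ≤ 1 := by
    rw [Finset.card_le_one]
    simp only [Finset.mem_filter, Finset.mem_univ, true_and, Fin.ext_iff]
    lia
  have h₂ : (Finset.univ.filter fun i : Fin n ↦ j.val + 1 = i.val).card ≤ 1 := by
    rw [Finset.card_le_one]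
    simp only [Finset.mem_filter, Finset.mem_univ, true_and, Fin.ext_iff]
    lia
  rw [Finset.sum_congr rfl fun i _ ↦ h i, Finset.sum_sub_distrib, Finset.sum_sub_distrib,
    Finset.sum_ite_eq', Finset.sum_boole, Finset.sum_boole, if_pos (Finset.mem_univ j)]
  lia

theorem IsTypeA.inner_sum_simple_nonneg (hP : IsEuclidean P) (hA : IsTypeA b e) (j : Fin n) :
    0 ≤ ⟪P.root (e j), ∑ i, P.root (e i)⟫_ℝ := by
  have h : 2 * ⟪P.root (e j), ∑ i, P.root (e i)⟫_ℝ =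
      ((∑ i, CartanMatrix.A n i j : ℤ) : ℝ) * ⟪P.root (e j), P.root (e j)⟫_ℝ := by
    rw [inner_sum, Finset.mul_sum, Int.cast_sum, Finset.sum_mul]
    refine Finset.sum_congr rfl fun i _ ↦ ?_
    rw [real_inner_comm, hP.two_mul_inner_root, hA.pairing_eq]
  have h₁ : (0 : ℝ) ≤ ((∑ i, CartanMatrix.A n i j : ℤ) : ℝ) := by
    exact_mod_cast sum_cartanMatrix_A_nonneg n j
  have h₂ := mul_nonneg h₁ (hP.inner_root_self_pos (e j)).le
  linarith

/-- Let $\theta = \sum \alpha_i$, a dominant root. Since $\alpha_0 - \theta$ is a sum of simple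
roots, $(\alpha_0 - \theta, \theta) \ge 0$; as $|\alpha_0| = |\theta|$, this gives $|\alpha_0 -
\theta|^2 = -2(\alpha_0 - \theta, \theta) \le 0$. -/
theorem IsTypeA.highestRoot_eq_sum [Finite ι] [P.IsReduced] (hP : IsEuclidean P) (hA : IsTypeA b e)
    (hn : 1 ≤ n) {r : ι} (hr : IsHighestRoot b r) : P.root r = ∑ i, P.root (e i) := by
  obtain ⟨t, ht⟩ := hA.exists_root_eq_sum hn
  have hnonneg : 0 ≤ ⟪P.root r - P.root t, P.root t⟫_ℝ := by
    refine AddSubmonoid.closure_induction (motive := fun x _ ↦ 0 ≤ ⟪x, P.root t⟫_ℝ) ?_ ?_ ?_ (hr t)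
    · rintro _ ⟨i, hi, rfl⟩
      simpa [ht] using hA.inner_sum_simple_nonneg hP (e.symm ⟨i, hi⟩)
    · simp
    · intro x y _ _ hx hy
      rw [inner_add_left]
      exact add_nonneg hx hy
  have hlen := hA.inner_root_self_eq hP r t
  have hsq : ⟪P.root r - P.root t, P.root r - P.root t⟫_ℝ ≤ 0 := by
    rw [inner_sub_left] at hnonneg
    rw [inner_sub_left, inner_sub_right, inner_sub_right, real_inner_comm (P.root r) (P.root t)]
    linarith
  rw [← ht]
  exact sub_eq_zero.mp (inner_self_eq_zero.mp (hsq.antisymm real_inner_self_nonneg))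

end TypeA

/-! ### Transfer of $\mathcal L$ to coordinates -/

section Coordinates

variable {ι V : Type*} [NormedAddCommGroup V] [InnerProductSpace ℝ V] [FiniteDimensional ℝ V]
  {P : RootPairing ι ℝ V V} [P.IsRootSystem] {b : P.Base} {n : ℕ}

/-- The coordinates `x ↦ (⟪α_i, x⟫)_i`. -/
noncomputable def simpleCoord (e : Fin n ≃ b.support) : V ≃ₗ[ℝ] (Fin n → ℝ) :=
  LinearMap.linearEquivOfInjective
    (LinearMap.pi fun i ↦ (innerₛₗ ℝ (P.root (e i)) : V →ₗ[ℝ] ℝ))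
    (by
      rw [← LinearMap.ker_eq_bot, LinearMap.ker_eq_bot']
      intro x hx
      have h : (innerₛₗ ℝ x : V →ₗ[ℝ] ℝ) = 0 := b.toWeightBasis.ext fun i ↦ by
        simpa [real_inner_comm] using congrFun hx (e.symm i)
      simpa using LinearMap.congr_fun h x)
    (by
      rw [Module.finrank_eq_card_basis b.toWeightBasis, Module.finrank_fin_fun,
        ← Fintype.card_congr e, Fintype.card_fin])

theorem simpleCoord_apply (e : Fin n ≃ b.support) (x : V) (i : Fin n) :
    simpleCoord e x i = ⟪P.root (e i), x⟫_ℝ := rfl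

end Coordinates

end AlcovePolytope

namespace AlcovePolytope

theorem isMinuscule_of_root_eq_sum {ι V : Type*} [NormedAddCommGroup V] [InnerProductSpace ℝ V]
    {P : RootPairing ι ℝ V V} [P.IsRootSystem] {b : P.Base} {n : ℕ} (e : Fin n ≃ b.support)
    {r : ι} (hr : P.root r = ∑ i, P.root (e i)) (j : b.support) : IsMinuscule b r j := by
  classical
  have h : P.root r = ∑ i, b.toWeightBasis i := by
    rw [hr, ← Equiv.sum_comp e]
    simp
  simp [IsMinuscule, h, Finsupp.single_apply]

theorem mem_fundamentalPolytopeA_iff {ι V : Type*} [NormedAddCommGroup V] [InnerProductSpace ℝ V]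
    [FiniteDimensional ℝ V] {P : RootPairing ι ℝ V V} [P.IsRootSystem] {b : P.Base} {n : ℕ}
    (hn : 1 ≤ n) (e : Fin n ≃ b.support) {r : ι} (hr : P.root r = ∑ i, P.root (e i)) (x : V) :
    x ∈ fundamentalPolytopeA b r e ↔ simpleCoord e x ∈ balancedPolytope (balancedSign n) := by
  have hsum : ⟪P.root r, x⟫_ℝ = ∑ i, simpleCoord e x i := by
    rw [hr, sum_inner]
    rfl
  have hbal : ⟪balancedRootA b e, x⟫_ℝ = ∑ i, balancedSign n i * simpleCoord e x i := by
    rw [sum_balancedSign_mul, balancedRootA, sum_inner]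
    exact Finset.sum_congr rfl fun i _ ↦ inner_sub_left _ _ _
  constructor
  · rintro ⟨⟨⟨h₁, -⟩, h₂⟩, h₃⟩
    refine ⟨fun i ↦ h₁ (e i), fun j ↦ ?_, hbal ▸ h₃⟩
    have := h₂ (e j) (isMinuscule_of_root_eq_sum e hr _)
    rwa [inner_add_left, hsum] at this
  · rintro ⟨h₁, h₂, h₃⟩
    refine ⟨⟨⟨fun i ↦ ?_, ?_⟩, fun j _ ↦ ?_⟩, hbal ▸ h₃⟩
    · simpa [simpleCoord_apply] using h₁ (e.symm i)
    -- The alcove wall $(\alpha_0, x) \le 1$ is redundant: it follows from one minuscule inequality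
    -- and $y_0 \ge 0$, where $n \ge 1$ supplies the index.
    · rw [hsum]
      linarith [h₁ ⟨0, hn⟩, h₂ ⟨0, hn⟩]
    · rw [inner_add_left, hsum]
      simpa [simpleCoord_apply] using h₂ (e.symm j)

end AlcovePolytope

theorem mainTheorem9 {ι V : Type*} [Finite ι]
    [NormedAddCommGroup V] [InnerProductSpace ℝ V] [FiniteDimensional ℝ V]
    (P : RootPairing ι ℝ V V) [P.IsRootSystem] [P.IsCrystallographic] [P.IsReduced]
    (hP : AlcovePolytope.IsEuclidean P)
    (b : P.Base) (n : ℕ) (hn : 1 ≤ n) (e : Fin n ≃ b.support)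
    (hA : AlcovePolytope.IsTypeA b e)
    (r : ι) (hr : AlcovePolytope.IsHighestRoot b r) :
    (((AlcovePolytope.fundamentalPolytopeA b r e).extremePoints ℝ).ncard : ℚ) =
      2 ^ (n - 1) + (3 - (-1) ^ n) / 4 * ((2 * (n / 2)).choose (n / 2) : ℚ) := by
  have hroot := hA.highestRoot_eq_sum hP hn hr
  have himage : AlcovePolytope.simpleCoord e '' AlcovePolytope.fundamentalPolytopeA b r e =
      balancedPolytope (balancedSign n) := by
    ext y
    refine ⟨?_, fun hy ↦ ⟨(AlcovePolytope.simpleCoord e).symm y, ?_, by simp⟩⟩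
    · rintro ⟨x, hx, rfl⟩
      exact (AlcovePolytope.mem_fundamentalPolytopeA_iff hn e hroot x).mp hx
    · rw [AlcovePolytope.mem_fundamentalPolytopeA_iff hn e hroot]
      simpa using hy
  rw [← card_filter_sum_balancedSign_nonneg hn,
    ← Set.ncard_image_of_injective _ (AlcovePolytope.simpleCoord e).injective,
    image_extremePoints, himage, extremePoints_balancedPolytope (abs_balancedSign_le_one n),
    Set.ncard_image_of_injective _ balancedVertex_injective, ← Set.ncard_coe_finset]
  simp
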